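/- Let $N, q, t \ge 2$ be integers. Consider $N$ sites in a row, each with Hilbert space $\mathbb{C}^q$. One period of the one-dimensional brickwork circuit with open boundary is $U = U_{\mathrm{odd}}\,U_{\mathrm{even}}$, where $U_{\mathrm{odd}}$ (respectively $U_{\mathrm{even}}$) is the product of two-site gates acting on sites $i, i+1$ over all odd (respectively even) $i$ with $1 \le i < N$, and the gates are independent Haar random unitaries in $U(q^2)$. Let $$T = \mathbb{E}\left[U^{\otimes t} \otimes (U^*)^{\otimes t}\right]$$ be its $t$-th moment operator, where $U^*$ is the entrywise complex conjugate of $U$, and let the spectral gap $\Delta(N,q,t)$ be the difference between the largest and the second-largest eigenvalue of $T$ (in magnitude, counted without multiplicity; both exist). Then $$\Delta(N,q,t) \le 1 - \left(\frac{2q}{q^2+1}\cos\frac{\pi}{N}\right)^2 .$$ -/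

import Mathlib

open MeasureTheory

noncomputable section

namespace Brickwork

/-- A unitary gate on a pair of sites, each of local dimension `q`. -/
abbrev Gate (q : ℕ) : Type := Matrix.unitaryGroup (Fin q × Fin q) ℂ

instance gateMeasurableSpace (q : ℕ) : MeasurableSpace (Gate q) := borel _

instance gateBorelSpace (q : ℕ) : BorelSpace (Gate q) := ⟨rfl⟩

instance gateCompactSpace (q : ℕ) : CompactSpace (Gate q) := by
  have hK : IsCompact (Set.univ.pi fun _ : Fin q × Fin q =>
      Set.univ.pi fun _ : Fin q × Fin q => Metric.closedBall (0 : ℂ) 1) :=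
    isCompact_univ_pi fun _ => isCompact_univ_pi fun _ => isCompact_closedBall _ _
  refine isCompact_iff_compactSpace.mp (hK.of_isClosed_subset
    (isClosed_unitary (R := Matrix (Fin q × Fin q) (Fin q × Fin q) ℂ)) ?_)
  intro U hU i _ j _
  simpa using entry_norm_bound_of_unitary hU i j

/-- The Haar probability measure on the unitary group of a pair of sites. -/
def gateHaar (q : ℕ) : Measure (Gate q) := Measure.haarMeasure ⊤

/-- Computational basis states of `N` sites of local dimension `q`. -/
abbrev Config (N q : ℕ) : Type := Fin N → Fin q

/-- The operator on `N` sites that acts by `u` on the sites `i`, `j` and by the identity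
on all other sites. -/
def actOn {N q : ℕ} (i j : Fin N) (u : Gate q) : Matrix (Config N q) (Config N q) ℂ :=
  Matrix.of fun x y =>
    if ∀ k, k ≠ i → k ≠ j → x k = y k then u.1 (x i, x j) (y i, y j) else 0

/-- The bond `b` joins the consecutive sites `b` and `b + 1`; sites are numbered from `0`. -/
def bondGate {N q : ℕ} (b : Fin (N - 1)) (u : Gate q) : Matrix (Config N q) (Config N q) ℂ :=
  actOn ⟨b.1, by omega⟩ ⟨b.1 + 1, by omega⟩ u

/-- The product of the gates `g b` over the bonds `b` with `b % 2 = r`. These gates act on disjoint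
pairs of sites. In the numbering of the sites from `1`, `r = 0` is the odd layer and `r = 1`
is the even layer. -/
def layer {N q : ℕ} (r : ℕ) (g : Fin (N - 1) → Gate q) : Matrix (Config N q) (Config N q) ℂ :=
  (((List.finRange (N - 1)).filter fun b => b.1 % 2 = r).map fun b => bondGate b (g b)).prod

/-- One period of the one-dimensional brickwork circuit (open boundary): an odd layer and an even
layer. Every bond carries exactly one gate. -/
def circuit {N q : ℕ} (g : Fin (N - 1) → Gate q) : Matrix (Config N q) (Config N q) ℂ :=
  layer 0 g * layer 1 g

/-- The `t`-th moment operator `𝔼[U^{⊗ t} ⊗ (U^*)^{⊗ t}]` of a random matrix `U`, where `U^*` is the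
entrywise complex conjugate. -/
def momentOperator {Ω S : Type*} [MeasurableSpace Ω] (μ : Measure Ω) (U : Ω → Matrix S S ℂ)
    (t : ℕ) : Matrix ((Fin t → S) × (Fin t → S)) ((Fin t → S) × (Fin t → S)) ℂ :=
  Matrix.of fun x y =>
    ∫ ω, (∏ k, U ω (x.1 k) (y.1 k)) * ∏ k, (starRingEnd ℂ) (U ω (x.2 k) (y.2 k)) ∂μ

/-- The `t`-th moment operator of one brickwork period with independent Haar random gates. -/
def transferMatrix (N q t : ℕ) :
    Matrix ((Fin t → Config N q) × (Fin t → Config N q))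
      ((Fin t → Config N q) × (Fin t → Config N q)) ℂ :=
  momentOperator (Measure.pi fun _ : Fin (N - 1) => gateHaar q) circuit t

/-- The set of magnitudes of the eigenvalues of a complex matrix. -/
def eigenvalueMagnitudes {n : Type*} [Fintype n] [DecidableEq n] (M : Matrix n n ℂ) : Set ℝ :=
  {r | ∃ z : ℂ, Module.End.HasEigenvalue (Matrix.toLin' M) z ∧ ‖z‖ = r}

/-- `Δ` is the difference between the largest and the second-largest eigenvalue of `M`, both in
magnitude and counted without multiplicity. -/
def IsSpectralGap {n : Type*} [Fintype n] [DecidableEq n] (M : Matrix n n ℂ) (Δ : ℝ) : Prop :=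
  ∃ a b : ℝ, IsGreatest (eigenvalueMagnitudes M) a ∧
    IsGreatest (eigenvalueMagnitudes M \ {a}) b ∧ Δ = a - b

theorem IsSpectralGap.unique {n : Type*} [Fintype n] [DecidableEq n] {M : Matrix n n ℂ}
    {Δ Δ' : ℝ} (h : IsSpectralGap M Δ) (h' : IsSpectralGap M Δ') : Δ = Δ' := by
  obtain ⟨a, b, ha, hb, rfl⟩ := h
  obtain ⟨a', b', ha', hb', rfl⟩ := h'
  obtain rfl := ha.unique ha'
  rw [hb.unique hb']

end Brickwork

end

open MeasureTheory

noncomputable section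

namespace Brickwork

open scoped Kronecker

/-! The bound comes from an explicit eigenvalue of `T`. Since `T` need not be normal, no variational
argument is used: an exact eigenvector is built from domain walls.

Independence turns `T` into a product of two layers, each a product of single-bond Haar averages
(`transferMatrix_eq_mul`). Pair the `t` copies of `U` with the `t` copies of `U*` by the identity
permutation on the sites before `k`, and by a transposition of two copies on the others; this is
`wallVec` with its wall at `k`. A Haar average on a bond fixes this vector unless the wall lies in
the middle of that bond. In that case the commutant of `V ⊗ V`, spanned by the identity and the
swap, forces the wall to move one site left or right, each with weight `q / (q ^ 2 + 1)`
(`twirl_siteSwap`, `bondProj_mulVec_wallVec_self`).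

So the span of the wall vectors is invariant, and the wall performs a damped walk absorbed at `0`
and `N`, where the vectors are uniform and fixed by `T`. Modulo these two, the standing wave `sin (k
π / N)` gains a factor `2 q / (q ^ 2 + 1) * cos (π / N)` per layer (`layerProj_mulVec_waveVec`). One
period therefore gives its square `z < 1`, and the uniform remainder can be absorbed because `z ≠
1`. As an average of unitaries, `T` has spectral radius at most `1`, and a uniform vector attains
`1`; hence the second magnitude is at least `z`. -/

instance gateSecondCountableTopology (q : ℕ) : SecondCountableTopology (Gate q) := by
  have : SecondCountableTopology (Matrix (Fin q × Fin q) (Fin q × Fin q) ℂ) :=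
    inferInstanceAs (SecondCountableTopology (Fin q × Fin q → Fin q × Fin q → ℂ))
  exact TopologicalSpace.Subtype.secondCountableTopology _

instance gateHaar_isHaarMeasure (q : ℕ) : (gateHaar q).IsHaarMeasure := by
  unfold gateHaar; infer_instance

instance gateHaar_isProbabilityMeasure (q : ℕ) : IsProbabilityMeasure (gateHaar q) :=
  ⟨Measure.haarMeasure_self (K₀ := (⊤ : TopologicalSpace.PositiveCompacts (Gate q)))⟩

/-! ### Integrals over independent coordinates -/

section Independence

theorem integrable_of_continuous {X : Type*} [MeasurableSpace X] [TopologicalSpace X]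
    [CompactSpace X] [OpensMeasurableSpace X] {μ : Measure X} [IsFiniteMeasure μ] {f : X → ℂ}
    (hf : Continuous f) : Integrable f μ :=
  hf.integrable_of_hasCompactSupport (HasCompactSupport.of_compactSpace f)

variable {ι Ω : Type*} [Fintype ι] [DecidableEq ι] [MeasurableSpace Ω]

/-- Resampling one coordinate preserves a product probability measure. -/
theorem measurePreserving_update_pi (μ : Measure Ω) [IsProbabilityMeasure μ] (b : ι) :
    MeasurePreserving (fun p : Ω × (ι → Ω) => Function.update p.2 b p.1)
      (μ.prod (Measure.pi fun _ : ι => μ)) (Measure.pi fun _ : ι => μ) := by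
  have hm : Measurable (fun p : Ω × (ι → Ω) => Function.update p.2 b p.1) := by
    refine measurable_pi_lambda _ fun i => ?_
    by_cases h : i = b
    · subst h; simpa using measurable_fst
    · simp only [Function.update_of_ne h]
      exact (measurable_pi_apply i).comp measurable_snd
  refine ⟨hm, (Measure.pi_eq fun s hs => ?_).symm⟩
  rw [Measure.map_apply hm (MeasurableSet.univ_pi hs)]
  have : (fun p : Ω × (ι → Ω) => Function.update p.2 b p.1) ⁻¹' Set.univ.pi s
      = s b ×ˢ Set.univ.pi (Function.update s b Set.univ) := by
    ext ⟨u, g⟩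
    simp only [Set.mem_preimage, Set.mem_pi, Set.mem_univ, true_implies, Set.mem_prod]
    constructor
    · intro h
      refine ⟨by simpa using h b, fun i => ?_⟩
      by_cases hi : i = b
      · subst hi; simp
      · simpa [Function.update_of_ne hi] using h i
    · rintro ⟨h1, h2⟩ i
      by_cases hi : i = b
      · subst hi; simpa using h1
      · simpa [Function.update_of_ne hi] using h2 i
  rw [this, Measure.prod_prod, Measure.pi_pi,
    ← Finset.mul_prod_erase Finset.univ _ (Finset.mem_univ b),
    ← Finset.mul_prod_erase Finset.univ (fun i => μ (s i)) (Finset.mem_univ b)]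
  simp only [Function.update_self, measure_univ, one_mul]
  congr 1
  refine Finset.prod_congr rfl fun i hi => ?_
  rw [Function.update_of_ne (Finset.ne_of_mem_erase hi)]

/-- Resampling coordinate `b` by an independent copy leaves `F` untouched, so the integrand becomes
a product of functions of separate variables. -/
theorem integral_pi_eval_mul (μ : Measure Ω) [IsProbabilityMeasure μ] (b : ι) {f : Ω → ℂ}
    {F : (ι → Ω) → ℂ} (hm : Measurable fun g : ι → Ω => f (g b) * F g)
    (hF : ∀ g u, F (Function.update g b u) = F g) :
    ∫ g, f (g b) * F g ∂(Measure.pi fun _ : ι => μ)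
      = (∫ u, f u ∂μ) * ∫ g, F g ∂(Measure.pi fun _ : ι => μ) := by
  have h := measurePreserving_update_pi μ b
  conv_lhs => rw [← h.map_eq]
  rw [integral_map h.measurable.aemeasurable hm.aestronglyMeasurable]
  simp only [Function.update_self, hF]
  exact integral_prod_mul f F

variable [TopologicalSpace Ω] [CompactSpace Ω] [BorelSpace Ω] [SecondCountableTopology Ω]

/-- The average of a product of independent random matrices is the product of the averages. -/
theorem integral_pi_list_prod {n : Type*} [Fintype n] [DecidableEq n] (μ : Measure Ω)
    [IsProbabilityMeasure μ] {B : ι → Ω → Matrix n n ℂ} (hB : ∀ b, Continuous (B b))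
    {l : List ι} (hl : l.Nodup) (x y : n) :
    ∫ g, (l.map fun b => B b (g b)).prod x y ∂(Measure.pi fun _ : ι => μ)
      = (l.map fun b => Matrix.of fun x y => ∫ u, B b u x y ∂μ).prod x y := by
  induction l generalizing x y with
  | nil => simp
  | cons b l ih =>
    have hBg : ∀ c, Continuous fun g : ι → Ω => B c (g c) := fun c =>
      (hB c).comp (continuous_apply c)
    have hc : Continuous fun g : ι → Ω => (l.map fun b => B b (g b)).prod :=
      continuous_list_prod l fun c _ => hBg c
    have hcont : ∀ z, Continuous fun g : ι → Ω =>
        B b (g b) x z * (l.map fun b => B b (g b)).prod z y := fun z =>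
      ((hBg b).matrix_elem x z).mul (hc.matrix_elem z y)
    simp only [List.map_cons, List.prod_cons, Matrix.mul_apply]
    rw [integral_finsetSum _ fun z _ => integrable_of_continuous (hcont z)]
    refine Finset.sum_congr rfl fun z _ => ?_
    rw [integral_pi_eval_mul μ b (f := fun u => B b u x z)
      (F := fun g => (l.map fun b => B b (g b)).prod z y) (hcont z).measurable, ih hl.of_cons]
    · rfl
    · intro g u
      have : (l.map fun c => B c (Function.update g b u c)) = l.map fun c => B c (g c) := by
        refine List.map_congr_left fun c hc => ?_
        rw [Function.update_of_ne]
        rintro rfl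
        exact (List.nodup_cons.mp hl).1 hc
      rw [this]

end Independence

/-! ### The tensor power `U^{⊗ t} ⊗ (U^*)^{⊗ t}` -/

section Moment

theorem sum_pi_prod {S : Type*} [Fintype S] {t : ℕ} (f : Fin t → S → ℂ) :
    ∑ z : Fin t → S, ∏ k, f k (z k) = ∏ k, ∑ s, f k s := by
  rw [Finset.prod_univ_sum, Fintype.piFinset_univ]

variable {S : Type*}

/-- The matrix `U^{⊗ t} ⊗ (U^*)^{⊗ t}`. -/
def moment (t : ℕ) (U : Matrix S S ℂ) :
    Matrix ((Fin t → S) × (Fin t → S)) ((Fin t → S) × (Fin t → S)) ℂ :=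
  Matrix.of fun x y => (∏ k, U (x.1 k) (y.1 k)) * ∏ k, (starRingEnd ℂ) (U (x.2 k) (y.2 k))

theorem moment_apply (t : ℕ) (U : Matrix S S ℂ) (x y : (Fin t → S) × (Fin t → S)) :
    moment t U x y
      = (∏ k, U (x.1 k) (y.1 k)) * ∏ k, (starRingEnd ℂ) (U (x.2 k) (y.2 k)) := rfl

theorem continuous_moment (t : ℕ) : Continuous (moment t : Matrix S S ℂ → _) := by
  refine continuous_matrix fun x y => ?_
  refine (continuous_finsetProd _ fun k _ => continuous_id.matrix_elem _ _).mul
    (continuous_finsetProd _ fun k _ => ?_)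
  exact Complex.continuous_conj.comp (continuous_id.matrix_elem _ _)

theorem moment_conjTranspose (t : ℕ) (U : Matrix S S ℂ) :
    moment t U.conjTranspose = (moment t U).conjTranspose := by
  ext x y
  simp [moment_apply, Matrix.conjTranspose_apply]

theorem moment_one [DecidableEq S] (t : ℕ) : moment t (1 : Matrix S S ℂ) = 1 := by
  ext x y
  simp only [moment_apply, Matrix.one_apply, apply_ite (starRingEnd ℂ), map_one, map_zero,
    Finset.prod_ite_zero, Finset.prod_const_one, Finset.mem_univ, true_implies, Prod.ext_iff,
    funext_iff]
  by_cases h1 : ∀ i, x.1 i = y.1 i <;> by_cases h2 : ∀ i, x.2 i = y.2 i <;> simp [h1, h2]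

variable [Fintype S]

theorem moment_mul (t : ℕ) (U V : Matrix S S ℂ) : moment t (U * V) = moment t U * moment t V := by
  ext x y
  rw [Matrix.mul_apply, Fintype.sum_prod_type]
  simp only [moment_apply, Matrix.mul_apply, map_sum, map_mul]
  rw [← sum_pi_prod fun k s => U (x.1 k) s * V s (y.1 k),
    ← sum_pi_prod fun k s => (starRingEnd ℂ) (U (x.2 k) s) * (starRingEnd ℂ) (V s (y.2 k)),
    Finset.sum_mul_sum]
  refine Finset.sum_congr rfl fun z _ => Finset.sum_congr rfl fun w _ => ?_
  simp only [Finset.prod_mul_distrib]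
  ring

variable [DecidableEq S]

theorem moment_list_prod (t : ℕ) (l : List (Matrix S S ℂ)) :
    moment t l.prod = (l.map (moment t)).prod := by
  induction l with
  | nil => simp [moment_one]
  | cons a l ih => simp [moment_mul, ih]

theorem moment_mem_unitary (t : ℕ) {U : Matrix S S ℂ} (hU : U ∈ Matrix.unitaryGroup S ℂ) :
    moment t U ∈ Matrix.unitaryGroup ((Fin t → S) × (Fin t → S)) ℂ := by
  rw [Matrix.mem_unitaryGroup_iff, Matrix.star_eq_conjTranspose, ← moment_conjTranspose,
    ← moment_mul, ← Matrix.star_eq_conjTranspose, Matrix.mem_unitaryGroup_iff.mp hU, moment_one]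

end Moment

/-! ### Averages of unitary matrices -/

section Contraction

variable {n : Type*} [Fintype n] [DecidableEq n]

theorem sum_norm_sq_mulVec_of_unitary {V : Matrix n n ℂ} (hV : V ∈ Matrix.unitaryGroup n ℂ)
    (v : n → ℂ) : ∑ i, ‖(V.mulVec v) i‖ ^ 2 = ∑ i, ‖v i‖ ^ 2 := by
  have key : ∀ w : n → ℂ, ((∑ i, ‖w i‖ ^ 2 : ℝ) : ℂ) = star w ⬝ᵥ w := by
    intro w
    simp [dotProduct, Complex.conj_mul']
  have : star (V.mulVec v) ⬝ᵥ V.mulVec v = star v ⬝ᵥ v := by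
    rw [Matrix.star_mulVec, Matrix.dotProduct_mulVec, Matrix.vecMul_vecMul,
      ← Matrix.star_eq_conjTranspose, Matrix.mem_unitaryGroup_iff'.mp hV, Matrix.vecMul_one]
  rw [← key, ← key] at this
  exact_mod_cast this

/-- Cauchy–Schwarz in the form `a b ≤ (a ^ 2 + b ^ 2) / 2`, which suffices because `V` preserves the
norm of `v`. -/
theorem norm_dotProduct_mulVec_le_of_unitary {V : Matrix n n ℂ}
    (hV : V ∈ Matrix.unitaryGroup n ℂ) (v : n → ℂ) :
    ‖star v ⬝ᵥ V.mulVec v‖ ≤ ∑ i, ‖v i‖ ^ 2 := by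
  calc ‖star v ⬝ᵥ V.mulVec v‖ ≤ ∑ i, ‖v i‖ * ‖V.mulVec v i‖ := by
        refine (norm_sum_le _ _).trans_eq (Finset.sum_congr rfl fun i _ => ?_)
        simp
    _ ≤ ∑ i, (‖v i‖ ^ 2 + ‖V.mulVec v i‖ ^ 2) / 2 :=
        Finset.sum_le_sum fun i _ => by nlinarith [sq_nonneg (‖v i‖ - ‖V.mulVec v i‖)]
    _ = ∑ i, ‖v i‖ ^ 2 := by
        rw [← Finset.sum_div, Finset.sum_add_distrib, sum_norm_sq_mulVec_of_unitary hV]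
        ring

/-- An average of unitary matrices has all its eigenvalues in the closed unit disc. -/
theorem norm_eigenvalue_average_le_one {X : Type*} [MeasurableSpace X] [TopologicalSpace X]
    [CompactSpace X] [OpensMeasurableSpace X] {μ : Measure X} [IsProbabilityMeasure μ]
    {V : X → Matrix n n ℂ} (hc : Continuous V) (hV : ∀ ω, V ω ∈ Matrix.unitaryGroup n ℂ) {z : ℂ}
    (hz : Module.End.HasEigenvalue
      (Matrix.toLin' (Matrix.of fun x y => ∫ ω, V ω x y ∂μ)) z) : ‖z‖ ≤ 1 := by
  obtain ⟨v, hv⟩ := hz.exists_hasEigenvector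
  have hpos : 0 < ∑ i, ‖v i‖ ^ 2 := by
    obtain ⟨i, hi⟩ := Function.ne_iff.mp hv.2
    exact Finset.sum_pos' (fun _ _ => by positivity)
      ⟨i, Finset.mem_univ _, by have : 0 < ‖v i‖ := norm_pos_iff.mpr hi; positivity⟩
  have hV_integrable : ∀ x y, Integrable (fun ω => V ω x y) μ := fun x y =>
    integrable_of_continuous (hc.matrix_elem x y)
  -- The quadratic form at an eigenvector of the average is the average of the quadratic forms, each
  -- bounded by the squared norm of `v`.
  have havg : ∫ ω, star v ⬝ᵥ (V ω).mulVec v ∂μ = z * (star v ⬝ᵥ v) := by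
    have h1 := hv.apply_eq_smul
    rw [Matrix.toLin'_apply] at h1
    rw [← smul_eq_mul, ← dotProduct_smul, ← h1]
    simp only [dotProduct, Matrix.mulVec, Matrix.of_apply]
    rw [integral_finsetSum _ fun x _ => (integrable_finsetSum _ fun y _ =>
      (hV_integrable x y).mul_const _).const_mul _]
    refine Finset.sum_congr rfl fun x _ => ?_
    rw [integral_const_mul, integral_finsetSum _ fun y _ => (hV_integrable x y).mul_const _]
    congr 1
    exact Finset.sum_congr rfl fun y _ => integral_mul_const _ _
  have hle : ‖z * (star v ⬝ᵥ v)‖ ≤ ∑ i, ‖v i‖ ^ 2 := by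
    rw [← havg]
    simpa using norm_integral_le_of_norm_le_const (μ := μ)
      (Filter.Eventually.of_forall fun ω => norm_dotProduct_mulVec_le_of_unitary (hV ω) v)
  have hvv : star v ⬝ᵥ v = ((∑ i, ‖v i‖ ^ 2 : ℝ) : ℂ) := by
    simp [dotProduct, Complex.conj_mul']
  rw [norm_mul, hvv, Complex.norm_real, Real.norm_of_nonneg hpos.le] at hle
  exact le_of_mul_le_mul_right (by simpa using hle) hpos

end Contraction

/-! ### Two-site gates -/

section TwoSite

variable {N q : ℕ}

/-- The configuration `x` with the values at the sites `i`, `j` replaced by `s`. -/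
def setPair (i j : Fin N) (x : Config N q) (s : Fin q × Fin q) : Config N q :=
  Function.update (Function.update x i s.1) j s.2

theorem setPair_right (i j : Fin N) (x : Config N q) (s : Fin q × Fin q) :
    setPair i j x s j = s.2 := by simp [setPair]

theorem setPair_left {i j : Fin N} (h : i ≠ j) (x : Config N q) (s : Fin q × Fin q) :
    setPair i j x s i = s.1 := by simp [setPair, h]

theorem setPair_of_ne {i j k : Fin N} (hi : k ≠ i) (hj : k ≠ j) (x : Config N q)
    (s : Fin q × Fin q) : setPair i j x s k = x k := by simp [setPair, hi, hj]

theorem setPair_injective {i j : Fin N} (h : i ≠ j) (x : Config N q) :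
    Function.Injective (setPair i j x) := by
  intro s r hsr
  refine Prod.ext ?_ ?_
  · rw [← setPair_left h x s, hsr, setPair_left h]
  · rw [← setPair_right i j x s, hsr, setPair_right]

theorem setPair_self_of_agree {i j : Fin N} {x y : Config N q}
    (h : ∀ k, k ≠ i → k ≠ j → x k = y k) : setPair i j x (y i, y j) = y := by
  funext k
  by_cases hj : k = j
  · subst hj; simp [setPair]
  by_cases hi : k = i
  · subst hi; simp [setPair, hj]
  · rw [setPair_of_ne hi hj, h k hi hj]

theorem actOn_setPair {i j : Fin N} (h : i ≠ j) (u : Gate q) (x : Config N q)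
    (s : Fin q × Fin q) : actOn i j u x (setPair i j x s) = u.1 (x i, x j) s := by
  have : ∀ k, k ≠ i → k ≠ j → x k = setPair i j x s k := fun k hi hj =>
    (setPair_of_ne hi hj x s).symm
  simp only [actOn, Matrix.of_apply, if_pos this, setPair_left h, setPair_right]

theorem actOn_eq_zero {i j : Fin N} (u : Gate q) {x y : Config N q}
    (hy : y ∉ Set.range (setPair i j x)) : actOn i j u x y = 0 := by
  simp only [actOn, Matrix.of_apply]
  rw [if_neg]
  exact fun h => hy ⟨_, setPair_self_of_agree h⟩

theorem sum_actOn_mul {i j : Fin N} (h : i ≠ j) (u : Gate q) (x : Config N q)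
    (F : Config N q → ℂ) :
    ∑ y, actOn i j u x y * F y = ∑ s, u.1 (x i, x j) s * F (setPair i j x s) := by
  symm
  refine Fintype.sum_of_injective _ (setPair_injective h x) _ _ (fun y hy => ?_) fun s => ?_
  · rw [actOn_eq_zero u hy, zero_mul]
  · rw [actOn_setPair h]

/-- The ring homomorphism `c` is the identity for the copies of `U` and conjugation for the copies
of `U*`, so both are treated at once. -/
theorem sum_prod_actOn_mul {t : ℕ} {i j : Fin N} (h : i ≠ j) (c : ℂ →+* ℂ) (u : Gate q)
    (x : Fin t → Config N q) (F : (Fin t → Config N q) → ℂ) :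
    ∑ y : Fin t → Config N q, (∏ a, c (actOn i j u (x a) (y a))) * F y
      = ∑ s : Fin t → Fin q × Fin q, (∏ a, c (u.1 (x a i, x a j) (s a))) *
          F fun a => setPair i j (x a) (s a) := by
  symm
  refine Fintype.sum_of_injective (fun s a => setPair i j (x a) (s a)) ?_ _ _ (fun y hy => ?_)
    fun s => ?_
  · exact fun s r hsr => funext fun a => setPair_injective h (x a) (congrFun hsr a)
  · by_cases hall : ∀ a, y a ∈ Set.range (setPair i j (x a))
    · choose s hs using hall
      exact absurd ⟨s, funext hs⟩ hy
    · push Not at hall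
      obtain ⟨a, ha⟩ := hall
      rw [Finset.prod_eq_zero (Finset.mem_univ a), zero_mul]
      rw [actOn_eq_zero u ha, map_zero]
  · simp only [actOn_setPair h]

theorem actOn_mul {i j : Fin N} (h : i ≠ j) (u v : Gate q) :
    actOn i j u * actOn i j v = actOn i j (u * v) := by
  ext x y
  rw [Matrix.mul_apply, sum_actOn_mul h u x fun z => actOn i j v z y]
  have hiff : ∀ s : Fin q × Fin q, (∀ k, k ≠ i → k ≠ j → setPair i j x s k = y k) ↔
      ∀ k, k ≠ i → k ≠ j → x k = y k := fun s =>
    forall_congr' fun k => forall_congr' fun hi => forall_congr' fun hj => by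
      rw [setPair_of_ne hi hj]
  simp only [actOn, Matrix.of_apply, hiff, setPair_left h, setPair_right]
  split_ifs
  · simp [Matrix.mul_apply]
  · simp

theorem actOn_one {i j : Fin N} : actOn i j (1 : Gate q) = 1 := by
  ext x y
  simp only [actOn, Matrix.of_apply, OneMemClass.coe_one, Matrix.one_apply, Prod.mk.injEq]
  rw [← ite_and]
  refine if_congr ⟨?_, ?_⟩ rfl rfl
  · rintro ⟨h, hi, hj⟩
    funext k
    by_cases h1 : k = i
    · rw [h1, hi]
    by_cases h2 : k = j
    · rw [h2, hj]
    exact h k h1 h2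
  · rintro rfl
    exact ⟨fun _ _ _ => rfl, rfl, rfl⟩

theorem actOn_conjTranspose (i j : Fin N) (u : Gate q) :
    (actOn i j u).conjTranspose = actOn i j u⁻¹ := by
  ext x y
  have : ∀ k, (k ≠ i → k ≠ j → x k = y k) ↔ (k ≠ i → k ≠ j → y k = x k) := fun k => by
    rw [eq_comm]
  simp only [actOn, Matrix.conjTranspose_apply, Matrix.of_apply, this]
  split_ifs
  · rfl
  · simp

theorem actOn_mem_unitary {i j : Fin N} (h : i ≠ j) (u : Gate q) :
    actOn i j u ∈ Matrix.unitaryGroup (Config N q) ℂ := by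
  rw [Matrix.mem_unitaryGroup_iff, Matrix.star_eq_conjTranspose, actOn_conjTranspose,
    actOn_mul h, mul_inv_cancel, actOn_one]

theorem continuous_actOn (i j : Fin N) :
    Continuous (actOn i j : Gate q → Matrix (Config N q) (Config N q) ℂ) := by
  refine continuous_matrix fun x y => ?_
  simp only [actOn, Matrix.of_apply]
  split_ifs
  · exact continuous_subtype_val.matrix_elem _ _
  · exact continuous_const

theorem bondGate_mem_unitary (b : Fin (N - 1)) (u : Gate q) :
    bondGate b u ∈ Matrix.unitaryGroup (Config N q) ℂ :=
  actOn_mem_unitary (by simp [Fin.ext_iff]) u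

theorem continuous_bondGate (b : Fin (N - 1)) :
    Continuous (bondGate b : Gate q → Matrix (Config N q) (Config N q) ℂ) :=
  continuous_actOn _ _

theorem layer_mem_unitary (r : ℕ) (g : Fin (N - 1) → Gate q) :
    layer r g ∈ Matrix.unitaryGroup (Config N q) ℂ := by
  refine list_prod_mem fun A hA => ?_
  obtain ⟨b, _, rfl⟩ := List.mem_map.mp hA
  exact bondGate_mem_unitary b _

theorem continuous_circuit :
    Continuous (circuit : (Fin (N - 1) → Gate q) → Matrix (Config N q) (Config N q) ℂ) := by
  have : ∀ r, Continuous
      (layer r : (Fin (N - 1) → Gate q) → Matrix (Config N q) (Config N q) ℂ) := fun r =>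
    continuous_list_prod _ fun b _ => (continuous_bondGate b).comp (continuous_apply b)
  exact (this 0).mul (this 1)

theorem norm_eigenvalue_transferMatrix_le_one {t : ℕ} {z : ℂ}
    (hz : Module.End.HasEigenvalue (Matrix.toLin' (transferMatrix N q t)) z) : ‖z‖ ≤ 1 :=
  norm_eigenvalue_average_le_one (V := fun g => moment t (circuit g))
    ((continuous_moment t).comp continuous_circuit)
    (fun g => moment_mem_unitary t (mul_mem (layer_mem_unitary 0 g) (layer_mem_unitary 1 g))) hz

/-- The moment operator of a single Haar random gate on the bond `b`. -/
def bondProj (q t : ℕ) (b : Fin (N - 1)) :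
    Matrix ((Fin t → Config N q) × (Fin t → Config N q))
      ((Fin t → Config N q) × (Fin t → Config N q)) ℂ :=
  momentOperator (gateHaar q) (bondGate b) t

/-- The moment operator of one layer of the circuit. -/
def layerProj (N q t r : ℕ) :
    Matrix ((Fin t → Config N q) × (Fin t → Config N q))
      ((Fin t → Config N q) × (Fin t → Config N q)) ℂ :=
  (((List.finRange (N - 1)).filter fun b => b.1 % 2 = r).map (bondProj q t)).prod

/-- The tensor power is multiplicative, and the bonds of the two layers together form a list without
repetition, so the gates along it are independent. -/
theorem transferMatrix_eq_mul (N q t : ℕ) :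
    transferMatrix N q t = layerProj N q t 0 * layerProj N q t 1 := by
  set l : ℕ → List (Fin (N - 1)) := fun r => (List.finRange (N - 1)).filter fun b => b.1 % 2 = r
    with hl
  have hnd : (l 0 ++ l 1).Nodup := by
    refine List.nodup_append.mpr
      ⟨(List.nodup_finRange _).filter _, (List.nodup_finRange _).filter _, ?_⟩
    rintro a ha b hb rfl
    simp only [hl, List.mem_filter, decide_eq_true_eq] at ha hb
    omega
  have hmom : ∀ g : Fin (N - 1) → Gate q, moment t (circuit g)
      = ((l 0 ++ l 1).map fun b => moment t (bondGate b (g b))).prod := by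
    intro g
    simp only [circuit, layer, moment_mul, moment_list_prod, List.map_map, List.map_append,
      List.prod_append]
    rfl
  ext x y
  rw [layerProj, layerProj, ← List.prod_append, ← List.map_append]
  refine Eq.trans ?_ (integral_pi_list_prod (gateHaar q)
    (B := fun b u => moment t (bondGate b u))
    (fun b => (continuous_moment t).comp (continuous_bondGate b)) hnd x y)
  simp only [← hmom]
  rfl

end TwoSite

/-! ### The commutant of the tensor squares of unitaries -/

section Commutant

variable {S : Type*} [Fintype S] [DecidableEq S]

/-- The swap operator on two copies. -/
def swapMatrix (S : Type*) [DecidableEq S] : Matrix (S × S) (S × S) ℂ :=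
  Matrix.of fun p r => if p.1 = r.2 ∧ p.2 = r.1 then 1 else 0

theorem swapMatrix_mul_apply (A : Matrix (S × S) (S × S) ℂ) (p r : S × S) :
    (swapMatrix S * A) p r = A p.swap r := by
  rw [Matrix.mul_apply, Finset.sum_eq_single p.swap]
  · simp [swapMatrix]
  · intro b _ hb
    have : ¬ (p.1 = b.2 ∧ p.2 = b.1) := fun h => hb (Prod.ext h.2.symm h.1.symm)
    simp [swapMatrix, this]
  · simp

theorem mul_swapMatrix_apply (A : Matrix (S × S) (S × S) ℂ) (p r : S × S) :
    (A * swapMatrix S) p r = A p r.swap := by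
  rw [Matrix.mul_apply, Finset.sum_eq_single r.swap]
  · simp [swapMatrix]
  · intro b _ hb
    have : ¬ (b.1 = r.2 ∧ b.2 = r.1) := fun h => hb (Prod.ext h.1 h.2)
    simp [swapMatrix, this]
  · simp

theorem swapMatrix_commute_kronecker (V : Matrix S S ℂ) :
    swapMatrix S * (V ⊗ₖ V) = (V ⊗ₖ V) * swapMatrix S := by
  ext p r
  rw [swapMatrix_mul_apply, mul_swapMatrix_apply]
  simp [Matrix.kroneckerMap_apply, mul_comm]

theorem diagonal_mem_unitary {z : S → ℂ} (hz : ∀ s, z s * star (z s) = 1) :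
    Matrix.diagonal z ∈ Matrix.unitaryGroup S ℂ := by
  rw [Matrix.mem_unitaryGroup_iff, Matrix.star_eq_conjTranspose, Matrix.diagonal_conjTranspose,
    Matrix.diagonal_mul_diagonal]
  simp only [Pi.star_apply, hz]
  exact Matrix.diagonal_one

theorem permMatrix_mem_unitary (σ : Equiv.Perm S) :
    σ.permMatrix ℂ ∈ Matrix.unitaryGroup S ℂ := by
  rw [Matrix.mem_unitaryGroup_iff, Matrix.star_eq_conjTranspose, Matrix.conjTranspose_permMatrix,
    ← Matrix.permMatrix_mul, inv_mul_cancel, Matrix.permMatrix_one]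

/-- A rotation that mixes `a` and `b`. -/
theorem swap_rotation_mem_unitary (a b : S) :
    ((3 / 5 : ℂ) • (1 : Matrix S S ℂ) + (4 / 5 * Complex.I) • (Equiv.swap a b).permMatrix ℂ)
      ∈ Matrix.unitaryGroup S ℂ := by
  have h2 : (Equiv.swap a b).permMatrix ℂ * (Equiv.swap a b).permMatrix ℂ = 1 := by
    rw [← Matrix.permMatrix_mul, Equiv.swap_mul_self, Matrix.permMatrix_one]
  have h1 : ((Equiv.swap a b).permMatrix ℂ).conjTranspose = (Equiv.swap a b).permMatrix ℂ := by
    rw [Matrix.conjTranspose_permMatrix, Equiv.swap_inv]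
  rw [Matrix.mem_unitaryGroup_iff, Matrix.star_eq_conjTranspose, Matrix.conjTranspose_add,
    Matrix.conjTranspose_smul, Matrix.conjTranspose_smul, h1, Matrix.conjTranspose_one]
  simp only [add_mul, mul_add, Matrix.smul_mul, Matrix.mul_smul, one_mul, mul_one, h2, smul_smul]
  have e3 : star (3 / 5 : ℂ) = 3 / 5 := by simp
  have e4 : star (4 / 5 * Complex.I) = - (4 / 5 * Complex.I) := by simp
  ext i j
  simp only [Matrix.add_apply, Matrix.smul_apply, smul_eq_mul, e3]
  rw [e4]
  ring_nf
  rw [Complex.I_sq]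
  ring

/-- A matrix that commutes with `V ⊗ V` for all unitary `V` is a combination of the identity and
the swap. -/
theorem exists_eq_smul_one_add_smul_swap [Nontrivial S] {Y : Matrix (S × S) (S × S) ℂ}
    (hY : ∀ V ∈ Matrix.unitaryGroup S ℂ, (V ⊗ₖ V) * Y = Y * (V ⊗ₖ V)) :
    ∃ α β : ℂ, Y = α • (1 : Matrix (S × S) (S × S) ℂ) + β • swapMatrix S := by
  have hdiag : ∀ z : S → ℂ, (∀ s, z s * star (z s) = 1) → ∀ a b c d,
      z a * z b * Y (a, b) (c, d) = Y (a, b) (c, d) * (z c * z d) := by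
    intro z hz a b c d
    have h := congrFun (congrFun (hY _ (diagonal_mem_unitary hz)) (a, b)) (c, d)
    rw [Matrix.diagonal_kronecker_diagonal, Matrix.diagonal_mul, Matrix.mul_diagonal] at h
    exact h
  -- A phase `I` on the single basis vector `p` counts how often `p` occurs in each pair: the values
  -- `1`, `I`, `-1` for zero, one, two occurrences are distinct. Hence a nonzero entry has equal
  -- multisets of row and column labels.
  have hphase : ∀ p a b c d : S, Y (a, b) (c, d) ≠ 0 →
      (if a = p then Complex.I else 1) * (if b = p then Complex.I else 1)
        = (if c = p then Complex.I else 1) * (if d = p then Complex.I else 1) := by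
    intro p a b c d hne
    have h := hdiag (fun s => if s = p then Complex.I else 1)
      (fun s => by split_ifs <;> simp) a b c d
    rw [mul_comm] at h
    exact mul_left_cancel₀ hne h
  have hI1 : Complex.I ≠ 1 := fun h => by simpa using congrArg Complex.re h
  have hIn1 : (-1 : ℂ) ≠ Complex.I := fun h => by simpa using congrArg Complex.re h
  have hn1 : (-1 : ℂ) ≠ 1 := by norm_num
  have hsupp : ∀ a b c d : S, Y (a, b) (c, d) ≠ 0 → (a = c ∧ b = d) ∨ (a = d ∧ b = c) := by
    intro a b c d hne
    have ha := hphase a a b c d hne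
    have hb := hphase b a b c d hne
    have hII := Complex.I_mul_I
    grind
  have hperm : ∀ (σ : Equiv.Perm S) (a b c d : S),
      Y (σ a, σ b) (σ c, σ d) = Y (a, b) (c, d) := by
    intro σ a b c d
    have h := congrFun (congrFun (hY _ (permMatrix_mem_unitary σ)) (a, b)) (σ c, σ d)
    rw [Matrix.mul_apply, Matrix.mul_apply, Finset.sum_eq_single (σ a, σ b),
      Finset.sum_eq_single (c, d)] at h
    · simpa [Matrix.kroneckerMap_apply, Equiv.Perm.permMatrix, PEquiv.toMatrix_apply] using h
    · rintro ⟨p, r⟩ _ hne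
      have : ¬ (σ p = σ c ∧ σ r = σ d) := by simpa using hne
      simp only [Matrix.kroneckerMap_apply, Equiv.Perm.permMatrix, PEquiv.toMatrix_apply]
      by_cases h1 : σ p = σ c <;> simp_all
    · simp
    · rintro ⟨p, r⟩ _ hne
      have : ¬ (σ a = p ∧ σ b = r) := fun h => hne (Prod.ext h.1.symm h.2.symm)
      simp only [Matrix.kroneckerMap_apply, Equiv.Perm.permMatrix, PEquiv.toMatrix_apply]
      by_cases h1 : σ a = p <;> simp_all
    · simp
  have htrans : ∀ a b c d : S, a ≠ b → c ≠ d → ∃ σ : Equiv.Perm S, σ a = c ∧ σ b = d := by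
    intro a b c d hab hcd
    refine ⟨Equiv.swap (Equiv.swap a c b) d * Equiv.swap a c, ?_, ?_⟩
    · rw [Equiv.Perm.mul_apply, Equiv.swap_apply_left, Equiv.swap_apply_of_ne_of_ne _ hcd]
      intro h
      exact hab ((Equiv.swap a c).injective (by rw [Equiv.swap_apply_left]; exact h))
    · simp
  -- Permutations leave three constants; a rotation mixing `a` and `b` ties them together through
  -- one entry of the commutation relation. The values `3/5`, `4/5` are a rational cosine and sine
  -- with nonzero product.
  have hrot : ∀ a b : S, a ≠ b → Y (a, a) (a, a) = Y (a, b) (a, b) + Y (a, b) (b, a) := by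
    intro a b hab
    set V := (3 / 5 : ℂ) • (1 : Matrix S S ℂ) +
      (4 / 5 * Complex.I) • (Equiv.swap a b).permMatrix ℂ with hV
    have hVaa : V a a = 3 / 5 := by
      simp [hV, Equiv.Perm.permMatrix, PEquiv.toMatrix_apply, hab.symm]
    have hVba : V b a = 4 / 5 * Complex.I := by
      simp [hV, Equiv.Perm.permMatrix, PEquiv.toMatrix_apply, hab.symm]
    have h := congrFun (congrFun (hY V (swap_rotation_mem_unitary a b)) (a, b)) (a, a)
    rw [Matrix.mul_apply, Matrix.mul_apply, Finset.sum_eq_single (a, a),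
      Finset.sum_eq_add (a, b) (b, a)] at h
    · simp only [Matrix.kroneckerMap_apply, hVaa, hVba] at h
      have hne : (3 / 5 * (4 / 5 * Complex.I) : ℂ) ≠ 0 := by simp
      refine mul_left_cancel₀ hne ?_
      linear_combination h
    · simpa using fun h => absurd h hab
    · rintro ⟨p, r⟩ _ hne
      have : Y (a, b) (p, r) = 0 := by
        by_contra h0
        rcases hsupp _ _ _ _ h0 with ⟨rfl, rfl⟩ | ⟨rfl, rfl⟩ <;> simp at hne
      rw [this, zero_mul]
    · simp
    · simp
    · rintro ⟨p, r⟩ _ hne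
      have : Y (p, r) (a, a) = 0 := by
        by_contra h0
        rcases hsupp _ _ _ _ h0 with ⟨rfl, rfl⟩ | ⟨rfl, rfl⟩ <;> simp at hne
      rw [this, mul_zero]
    · simp
  obtain ⟨a, b, hab⟩ := exists_pair_ne S
  have hα : ∀ c d : S, c ≠ d → Y (c, d) (c, d) = Y (a, b) (a, b) := by
    intro c d hcd
    obtain ⟨σ, rfl, rfl⟩ := htrans a b c d hab hcd
    exact hperm σ _ _ _ _
  have hβ : ∀ c d : S, c ≠ d → Y (c, d) (d, c) = Y (a, b) (b, a) := by
    intro c d hcd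
    obtain ⟨σ, rfl, rfl⟩ := htrans a b c d hab hcd
    exact hperm σ _ _ _ _
  have hγ : ∀ c : S, Y (c, c) (c, c) = Y (a, b) (a, b) + Y (a, b) (b, a) := by
    intro c
    obtain ⟨d, hd⟩ := exists_ne c
    rw [hrot c d hd.symm, hα c d hd.symm, hβ c d hd.symm]
  refine ⟨Y (a, b) (a, b), Y (a, b) (b, a), ?_⟩
  ext ⟨c, d⟩ ⟨e, f⟩
  simp only [Matrix.add_apply, Matrix.smul_apply, Matrix.one_apply, swapMatrix, Matrix.of_apply,
    smul_eq_mul, Prod.mk.injEq]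
  by_cases h0 : Y (c, d) (e, f) = 0
  · by_cases h1 : c = e ∧ d = f <;> by_cases h2 : c = f ∧ d = e
    · obtain ⟨rfl, rfl⟩ := h1
      obtain ⟨rfl, -⟩ := h2
      simp [← hγ c]
    · obtain ⟨rfl, rfl⟩ := h1
      have hcd : c ≠ d := fun h => h2 ⟨h, h.symm⟩
      rw [if_neg h2, if_pos ⟨rfl, rfl⟩, ← hα c d hcd, h0]; simp
    · obtain ⟨rfl, rfl⟩ := h2
      have hcd : c ≠ d := fun h => h1 ⟨h, h.symm⟩
      rw [if_neg h1, if_pos ⟨rfl, rfl⟩, ← hβ c d hcd, h0]; simp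
    · rw [if_neg h1, if_neg h2, h0]; simp
  · rcases hsupp _ _ _ _ h0 with ⟨rfl, rfl⟩ | ⟨rfl, rfl⟩
    · by_cases hcd : c = d
      · subst hcd; simp [hγ c]
      · simp [hα c d hcd, hcd]
    · by_cases hcd : c = d
      · subst hcd; simp [hγ c]
      · simp [hβ c d hcd, hcd]

end Commutant

/-! ### Haar averages of two copies of a gate -/

section Twirl

variable {q : ℕ}

/-- Conjugation of a two-copy operator by `u ⊗ u`. -/
def conjPair {S : Type*} [Fintype S] (u : Matrix S S ℂ) (X : Matrix (S × S) (S × S) ℂ) :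
    Matrix (S × S) (S × S) ℂ :=
  (u ⊗ₖ u) * X * (u ⊗ₖ u).conjTranspose

/-- The Haar average of `(u ⊗ u) X (u ⊗ u)†`. -/
def twirl (q : ℕ) (X : Matrix ((Fin q × Fin q) × (Fin q × Fin q))
    ((Fin q × Fin q) × (Fin q × Fin q)) ℂ) :
    Matrix ((Fin q × Fin q) × (Fin q × Fin q)) ((Fin q × Fin q) × (Fin q × Fin q)) ℂ :=
  Matrix.of fun p r => ∫ u, conjPair (u : Gate q).1 X p r ∂(gateHaar q)

theorem kronecker_self_mul_conjTranspose {S : Type*} [Fintype S] [DecidableEq S]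
    {V : Matrix S S ℂ} (hV : V ∈ Matrix.unitaryGroup S ℂ) :
    (V ⊗ₖ V) * (V ⊗ₖ V).conjTranspose = 1 := by
  rw [Matrix.conjTranspose_kronecker, ← Matrix.mul_kronecker_mul, ← Matrix.star_eq_conjTranspose,
    Matrix.mem_unitaryGroup_iff.mp hV, Matrix.one_kronecker_one]

theorem conjTranspose_mul_kronecker_self {S : Type*} [Fintype S] [DecidableEq S]
    {V : Matrix S S ℂ} (hV : V ∈ Matrix.unitaryGroup S ℂ) :
    (V ⊗ₖ V).conjTranspose * (V ⊗ₖ V) = 1 := by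
  rw [Matrix.conjTranspose_kronecker, ← Matrix.mul_kronecker_mul, ← Matrix.star_eq_conjTranspose,
    Matrix.mem_unitaryGroup_iff'.mp hV, Matrix.one_kronecker_one]

theorem conjPair_mul {S : Type*} [Fintype S] (V u : Matrix S S ℂ)
    (X : Matrix (S × S) (S × S) ℂ) : conjPair (V * u) X = conjPair V (conjPair u X) := by
  simp only [conjPair, Matrix.mul_kronecker_mul, Matrix.conjTranspose_mul, Matrix.mul_assoc]

theorem conjPair_of_commute {S : Type*} [Fintype S] [DecidableEq S] {V : Matrix S S ℂ}
    (hV : V ∈ Matrix.unitaryGroup S ℂ) {X : Matrix (S × S) (S × S) ℂ}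
    (hX : X * (V ⊗ₖ V) = (V ⊗ₖ V) * X) : conjPair V X = X := by
  rw [conjPair, ← hX, Matrix.mul_assoc, kronecker_self_mul_conjTranspose hV, Matrix.mul_one]

theorem continuous_conjPair (X : Matrix ((Fin q × Fin q) × (Fin q × Fin q))
    ((Fin q × Fin q) × (Fin q × Fin q)) ℂ) :
    Continuous fun u : Gate q => conjPair u.1 X := by
  have hk : Continuous fun u : Gate q => u.1 ⊗ₖ u.1 := by
    refine continuous_matrix fun p r => ?_
    exact (continuous_subtype_val.matrix_elem _ _).mul (continuous_subtype_val.matrix_elem _ _)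
  exact (hk.mul continuous_const).mul hk.matrix_conjTranspose

theorem integral_mul_mul_apply {n X : Type*} [Fintype n] [MeasurableSpace X] {μ : Measure X}
    {F : X → Matrix n n ℂ} (hF : ∀ i j, Integrable (fun ω => F ω i j) μ) (A B : Matrix n n ℂ)
    (i j : n) :
    ∫ ω, (A * F ω * B) i j ∂μ = (A * (Matrix.of fun i j => ∫ ω, F ω i j ∂μ) * B) i j := by
  simp only [Matrix.mul_apply, Matrix.of_apply]
  rw [integral_finsetSum _ fun k _ => (integrable_finsetSum _ fun l _ =>
    (hF l k).const_mul _).mul_const _]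
  refine Finset.sum_congr rfl fun k _ => ?_
  rw [integral_mul_const, integral_finsetSum _ fun l _ => (hF l k).const_mul _]
  congr 1
  exact Finset.sum_congr rfl fun l _ => integral_const_mul _ _

variable (X : Matrix ((Fin q × Fin q) × (Fin q × Fin q)) ((Fin q × Fin q) × (Fin q × Fin q)) ℂ)

theorem integrable_conjPair (p r : (Fin q × Fin q) × (Fin q × Fin q)) :
    Integrable (fun u : Gate q => conjPair u.1 X p r) (gateHaar q) :=
  integrable_of_continuous ((continuous_conjPair X).matrix_elem p r)

/-- Left invariance of Haar measure. It puts the twirl in the commutant of all `V ⊗ V`. -/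
theorem conjPair_twirl (V : Gate q) : conjPair V.1 (twirl q X) = twirl q X := by
  ext p r
  have h : ∫ u : Gate q, conjPair (V * u).1 X p r ∂(gateHaar q) = twirl q X p r :=
    integral_mul_left_eq_self (fun u : Gate q => conjPair u.1 X p r) V
  rw [← h]
  simp only [Submonoid.coe_mul, conjPair_mul]
  exact (integral_mul_mul_apply (integrable_conjPair X) _ _ p r).symm

theorem twirl_commute {V : Matrix (Fin q × Fin q) (Fin q × Fin q) ℂ}
    (hV : V ∈ Matrix.unitaryGroup (Fin q × Fin q) ℂ) :
    (V ⊗ₖ V) * twirl q X = twirl q X * (V ⊗ₖ V) := by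
  conv_rhs => rw [← conjPair_twirl X ⟨V, hV⟩]
  rw [conjPair, Matrix.mul_assoc _ _ (V ⊗ₖ V), conjTranspose_mul_kronecker_self hV,
    Matrix.mul_one]

/-- The twirl preserves the trace against any operator that commutes with all `V ⊗ V`. -/
theorem trace_twirl_mul {B : Matrix ((Fin q × Fin q) × (Fin q × Fin q))
    ((Fin q × Fin q) × (Fin q × Fin q)) ℂ}
    (hB : ∀ V : Matrix (Fin q × Fin q) (Fin q × Fin q) ℂ, B * (V ⊗ₖ V) = (V ⊗ₖ V) * B) :
    (twirl q X * B).trace = (X * B).trace := by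
  -- The factor `1` only gives the integrand the shape `A * F * B` of `integral_mul_mul_apply`.
  have h : ∀ u : Gate q, (1 * conjPair u.1 X * B).trace = (X * B).trace := by
    intro u
    rw [Matrix.one_mul, Matrix.trace_mul_comm, conjPair, ← Matrix.mul_assoc, ← Matrix.mul_assoc,
      hB, Matrix.mul_assoc, Matrix.mul_assoc, Matrix.trace_mul_comm, Matrix.mul_assoc,
      Matrix.mul_assoc, conjTranspose_mul_kronecker_self u.2, Matrix.mul_one,
      Matrix.trace_mul_comm]
  have hc : Continuous fun u : Gate q => 1 * conjPair u.1 X * B :=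
    (continuous_const.mul (continuous_conjPair X)).mul continuous_const
  calc (twirl q X * B).trace
      = ∑ p, ∫ u : Gate q, (1 * conjPair u.1 X * B).diag p ∂(gateHaar q) := by
        refine Finset.sum_congr rfl fun p _ => ?_
        simp only [Matrix.diag_apply]
        rw [integral_mul_mul_apply (integrable_conjPair X), Matrix.one_mul]
        rfl
    _ = ∫ u : Gate q, (1 * conjPair u.1 X * B).trace ∂(gateHaar q) :=
        (integral_finsetSum _ fun p _ => integrable_of_continuous (hc.matrix_elem p p)).symm
    _ = (X * B).trace := by simp only [h]; simp

/-- The operator on two copies of two sites that swaps the copies of the second site. -/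
def siteSwap (q : ℕ) :
    Matrix ((Fin q × Fin q) × (Fin q × Fin q)) ((Fin q × Fin q) × (Fin q × Fin q)) ℂ :=
  Matrix.of fun p r =>
    if (p.1.1 = r.1.1 ∧ p.2.1 = r.2.1) ∧ p.1.2 = r.2.2 ∧ p.2.2 = r.1.2 then 1 else 0

theorem trace_siteSwap (q : ℕ) : (siteSwap q).trace = (q : ℂ) ^ 3 := by
  simp only [Matrix.trace, Matrix.diag, siteSwap, Matrix.of_apply, Fintype.sum_prod_type,
    true_and]
  have : ∀ a b : Fin q, (a = b ∧ b = a) ↔ a = b := fun a b => ⟨fun h => h.1, fun h => ⟨h, h.symm⟩⟩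
  simp [this]
  ring

theorem trace_siteSwap_mul_swap (q : ℕ) :
    (siteSwap q * swapMatrix (Fin q × Fin q)).trace = (q : ℂ) ^ 3 := by
  simp only [Matrix.trace, Matrix.diag, mul_swapMatrix_apply]
  simp only [siteSwap, Matrix.of_apply, Fintype.sum_prod_type, Prod.swap, and_true]
  have : ∀ a b : Fin q, (a = b ∧ b = a) ↔ a = b := fun a b => ⟨fun h => h.1, fun h => ⟨h, h.symm⟩⟩
  simp [this]
  ring

theorem trace_swapMatrix (S : Type*) [Fintype S] [DecidableEq S] :
    (swapMatrix S).trace = Fintype.card S := by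
  simp only [Matrix.trace, Matrix.diag, swapMatrix, Matrix.of_apply]
  rw [Fintype.sum_prod_type]
  have : ∀ a b : S, (a = b ∧ b = a) ↔ a = b := fun a b => ⟨fun h => h.1, fun h => ⟨h, h.symm⟩⟩
  simp [this]

theorem swapMatrix_mul_self (S : Type*) [Fintype S] [DecidableEq S] :
    swapMatrix S * swapMatrix S = 1 := by
  ext p r
  rw [swapMatrix_mul_apply]
  simp only [swapMatrix, Matrix.of_apply, Matrix.one_apply, Prod.fst_swap, Prod.snd_swap]
  exact if_congr ⟨fun h => Prod.ext h.2 h.1, fun h => by simp [h]⟩ rfl rfl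

/-- The twirl is `α + β · swap`. Its traces against the identity and the swap give `q ^ 4 α + q ^ 2
β = q ^ 3 = q ^ 2 α + q ^ 4 β`, which has a unique solution since `q ^ 2 ≠ 1`. -/
theorem twirl_siteSwap (hq : 2 ≤ q) :
    twirl q (siteSwap q)
      = ((q : ℂ) / ((q : ℂ) ^ 2 + 1)) • (1 + swapMatrix (Fin q × Fin q)) := by
  have : Nontrivial (Fin q × Fin q) := by
    have : NeZero q := ⟨by omega⟩
    have : Nontrivial (Fin q) := Fin.nontrivial_iff_two_le.mpr hq
    infer_instance
  obtain ⟨α, β, h⟩ := exists_eq_smul_one_add_smul_swap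
    (fun V hV => twirl_commute (siteSwap q) hV)
  have h1 := trace_twirl_mul (siteSwap q) (B := 1) (fun V => by rw [one_mul, mul_one])
  have h2 := trace_twirl_mul (siteSwap q) (B := swapMatrix _) swapMatrix_commute_kronecker
  rw [trace_siteSwap_mul_swap, h, Matrix.add_mul, Matrix.smul_mul, Matrix.smul_mul,
    Matrix.one_mul, swapMatrix_mul_self, Matrix.trace_add, Matrix.trace_smul, Matrix.trace_smul,
    trace_swapMatrix, Matrix.trace_one] at h2
  rw [Matrix.mul_one, Matrix.mul_one, trace_siteSwap, h, Matrix.trace_add, Matrix.trace_smul,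
    Matrix.trace_smul, trace_swapMatrix, Matrix.trace_one] at h1
  simp only [Fintype.card_prod, Fintype.card_fin, smul_eq_mul] at h1 h2
  push_cast at h1 h2
  have hq0 : (q : ℂ) ≠ 0 := by exact_mod_cast (by omega : q ≠ 0)
  have hq1 : (q : ℂ) ^ 2 + 1 ≠ 0 := by exact_mod_cast (by positivity : q ^ 2 + 1 ≠ 0)
  have hq2 : (q : ℂ) ^ 2 - 1 ≠ 0 := by
    have : (q : ℂ) ^ 2 ≠ 1 := by exact_mod_cast (by nlinarith : q ^ 2 ≠ 1)
    exact sub_ne_zero.mpr this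
  have hαβ : α = β := by
    have : (q : ℂ) ^ 2 * ((q : ℂ) ^ 2 - 1) * (α - β) = 0 := by linear_combination h1 - h2
    have := (mul_eq_zero.mp this).resolve_left (mul_ne_zero (pow_ne_zero 2 hq0) hq2)
    exact sub_eq_zero.mp this
  have hα : α = (q : ℂ) / ((q : ℂ) ^ 2 + 1) := by
    rw [eq_div_iff hq1]
    refine mul_left_cancel₀ (pow_ne_zero 2 hq0) ?_
    rw [← hαβ] at h1
    linear_combination h1
  rw [h, ← hαβ, ← hα, smul_add]

end Twirl

/-! ### Vectors given by an operator on two copies -/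

section PairVec

variable {S : Type*}

theorem sum_fin_add_two [Fintype S] {m : ℕ} (F : (Fin (m + 2) → S) → ℂ) :
    ∑ z, F z = ∑ p : S × S, ∑ z : Fin m → S,
      F (Fin.cons p.1 (Fin.cons p.2 z : Fin (m + 1) → S)) := by
  rw [← (Fin.consEquiv fun _ : Fin (m + 2) => S).sum_comp, Fintype.sum_prod_type,
    Fintype.sum_prod_type]
  refine Finset.sum_congr rfl fun a _ => ?_
  rw [← (Fin.consEquiv fun _ : Fin (m + 1) => S).sum_comp, Fintype.sum_prod_type]
  rfl

variable [DecidableEq S]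

/-- The vector of the operator `X` on the first two copies and the identity on the other ones. -/
def pairVec (m : ℕ) (X : Matrix (S × S) (S × S) ℂ)
    (x : (Fin (m + 2) → S) × (Fin (m + 2) → S)) : ℂ :=
  X (x.1 0, x.1 1) (x.2 0, x.2 1) *
    if (fun a : Fin m => x.1 a.succ.succ) = (fun a : Fin m => x.2 a.succ.succ) then 1 else 0

/-- Vectorization: `A ⊗ A*` acts on the vector of `X` as `A X A†`. On the remaining `m` copies the
operator is the identity, which unitary conjugation fixes. -/
theorem moment_mulVec_pairVec [Fintype S] (m : ℕ) {u : Matrix S S ℂ}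
    (hu : u ∈ Matrix.unitaryGroup S ℂ) (X : Matrix (S × S) (S × S) ℂ) :
    (moment (m + 2) u).mulVec (pairVec m X) = pairVec m (conjPair u X) := by
  funext ⟨x, y⟩
  have htail : (if (fun a : Fin m => x a.succ.succ) = (fun a : Fin m => y a.succ.succ)
      then (1 : ℂ) else 0) = ∑ z : Fin m → S,
        (∏ a, u (x a.succ.succ) (z a)) * ∏ a, (starRingEnd ℂ) (u (y a.succ.succ) (z a)) := by
    have huu : ∀ a b, ∑ s, u a s * (starRingEnd ℂ) (u b s) = if a = b then 1 else 0 := by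
      intro a b
      have := congrFun (congrFun (Matrix.mem_unitaryGroup_iff.mp hu) a) b
      rwa [Matrix.mul_apply, Matrix.one_apply] at this
    simp only [← Finset.prod_mul_distrib]
    rw [sum_pi_prod fun (a : Fin m) s =>
      u (x a.succ.succ) s * (starRingEnd ℂ) (u (y a.succ.succ) s)]
    simp only [huu, Finset.prod_ite_zero, Finset.prod_const_one, Finset.mem_univ, true_implies,
      funext_iff]
  simp only [pairVec, htail]
  rw [Matrix.mulVec, dotProduct, Fintype.sum_prod_type, sum_fin_add_two]
  simp only [sum_fin_add_two, pairVec, moment_apply, Fin.prod_univ_succ, Fin.cons_zero,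
    Fin.cons_succ, mul_ite, mul_one, mul_zero, Fin.cons_one, Finset.sum_ite_eq, Finset.mem_univ,
    if_true, Fin.succ_zero_eq_one]
  simp only [conjPair, Matrix.mul_apply, Matrix.conjTranspose_apply, Matrix.kroneckerMap_apply,
    Finset.sum_mul, Finset.mul_sum]
  rw [Finset.sum_comm]
  refine Finset.sum_congr rfl fun z _ => ?_
  rw [Finset.sum_comm]
  refine Finset.sum_congr rfl fun r _ => Finset.sum_congr rfl fun p _ => ?_
  simp only [star_mul', Complex.star_def]
  ring

theorem pairVec_smul_add (m : ℕ) (c : ℂ) (X Y : Matrix (S × S) (S × S) ℂ)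
    (x : (Fin (m + 2) → S) × (Fin (m + 2) → S)) :
    pairVec m (c • (X + Y)) x = c * (pairVec m X x + pairVec m Y x) := by
  simp only [pairVec, Matrix.smul_apply, Matrix.add_apply, smul_eq_mul]
  ring

end PairVec

theorem momentOperator_mulVec {Ω S : Type*} [Fintype S] [MeasurableSpace Ω] [TopologicalSpace Ω]
    [CompactSpace Ω] [OpensMeasurableSpace Ω] (μ : Measure Ω) [IsFiniteMeasure μ]
    {U : Ω → Matrix S S ℂ} (hU : Continuous U) (t : ℕ) (F : (Fin t → S) × (Fin t → S) → ℂ)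
    (x : (Fin t → S) × (Fin t → S)) :
    (momentOperator μ U t).mulVec F x = ∫ ω, (moment t (U ω)).mulVec F x ∂μ := by
  have hc : Continuous fun ω => moment t (U ω) := (continuous_moment t).comp hU
  simp only [Matrix.mulVec, dotProduct]
  rw [integral_finsetSum _ fun y _ =>
    (integrable_of_continuous (hc.matrix_elem x y)).mul_const _]
  exact Finset.sum_congr rfl fun y _ => (integral_mul_const _ _).symm

/-! ### Locality -/

section Locality

variable {N q : ℕ}

/-- The values of all copies at the sites `i`, `j`. -/
def pairAt {t : ℕ} (i j : Fin N) (x : (Fin t → Config N q) × (Fin t → Config N q)) :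
    (Fin t → Fin q × Fin q) × (Fin t → Fin q × Fin q) :=
  (fun a => (x.1 a i, x.1 a j), fun a => (x.2 a i, x.2 a j))

/-- The hypothesis `hR` says that `R` does not depend on the sites `i`, `j`, so it passes through
the gate and only the two-site factor `G` is transformed. -/
theorem moment_actOn_mulVec {t : ℕ} {i j : Fin N} (h : i ≠ j) (u : Gate q)
    {R : (Fin t → Config N q) × (Fin t → Config N q) → ℂ}
    (hR : ∀ x (s r : Fin t → Fin q × Fin q),
      R (fun a => setPair i j (x.1 a) (s a), fun a => setPair i j (x.2 a) (r a)) = R x)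
    (G : (Fin t → Fin q × Fin q) × (Fin t → Fin q × Fin q) → ℂ)
    (x : (Fin t → Config N q) × (Fin t → Config N q)) :
    (moment t (actOn i j u)).mulVec (fun x => R x * G (pairAt i j x)) x
      = R x * (moment t u.1).mulVec G (pairAt i j x) := by
  simp only [Matrix.mulVec, dotProduct, Fintype.sum_prod_type, moment_apply]
  have h1 : ∀ y : Fin t → Config N q, ∑ z : Fin t → Config N q,
      (∏ k, actOn i j u (x.1 k) (y k)) * (∏ k, (starRingEnd ℂ) (actOn i j u (x.2 k) (z k))) *
        (R (y, z) * G (pairAt i j (y, z)))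
      = (∏ k, RingHom.id ℂ (actOn i j u (x.1 k) (y k))) * ∑ r : Fin t → Fin q × Fin q,
        (∏ k, (starRingEnd ℂ) (u.1 (x.2 k i, x.2 k j) (r k))) *
          (R (y, fun a => setPair i j (x.2 a) (r a)) *
            G (pairAt i j (y, fun a => setPair i j (x.2 a) (r a)))) := by
    intro y
    rw [← sum_prod_actOn_mul h (starRingEnd ℂ) u x.2
      (fun z => R (y, z) * G (pairAt i j (y, z))), Finset.mul_sum]
    simp only [mul_assoc, RingHom.id_apply]
  simp only [h1]
  rw [sum_prod_actOn_mul h (RingHom.id ℂ) u x.1 (fun y => ∑ r : Fin t → Fin q × Fin q,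
        (∏ k, (starRingEnd ℂ) (u.1 (x.2 k i, x.2 k j) (r k))) *
          (R (y, fun a => setPair i j (x.2 a) (r a)) *
            G (pairAt i j (y, fun a => setPair i j (x.2 a) (r a)))))]
  simp only [hR, Finset.mul_sum, RingHom.id_apply]
  refine Finset.sum_congr rfl fun s _ => Finset.sum_congr rfl fun r _ => ?_
  simp only [pairAt, setPair_left h, setPair_right]
  ring

theorem momentOperator_actOn_mulVec {m : ℕ} {i j : Fin N} (h : i ≠ j)
    {R : (Fin (m + 2) → Config N q) × (Fin (m + 2) → Config N q) → ℂ}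
    (hR : ∀ x (s r : Fin (m + 2) → Fin q × Fin q),
      R (fun a => setPair i j (x.1 a) (s a), fun a => setPair i j (x.2 a) (r a)) = R x)
    (X : Matrix ((Fin q × Fin q) × (Fin q × Fin q)) ((Fin q × Fin q) × (Fin q × Fin q)) ℂ)
    (x : (Fin (m + 2) → Config N q) × (Fin (m + 2) → Config N q)) :
    (momentOperator (gateHaar q) (actOn i j) (m + 2)).mulVec
        (fun x => R x * pairVec m X (pairAt i j x)) x
      = R x * pairVec m (twirl q X) (pairAt i j x) := by
  rw [momentOperator_mulVec _ (continuous_actOn i j)]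
  have h1 : ∀ u : Gate q, (moment (m + 2) (actOn i j u)).mulVec
      (fun x => R x * pairVec m X (pairAt i j x)) x
      = R x * pairVec m (conjPair u.1 X) (pairAt i j x) := fun u => by
    rw [moment_actOn_mulVec h u hR, moment_mulVec_pairVec m u.2]
  simp only [h1]
  rw [integral_const_mul]
  congr 1
  exact integral_mul_const _ _

theorem twirl_one : twirl q 1 = 1 := by
  ext p r
  have : ∀ u : Gate q, conjPair u.1 1 = 1 := fun u =>
    conjPair_of_commute u.2 (by rw [one_mul, mul_one])
  simp [twirl, this]

theorem twirl_swap : twirl q (swapMatrix (Fin q × Fin q)) = swapMatrix (Fin q × Fin q) := by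
  ext p r
  have : ∀ u : Gate q, conjPair u.1 (swapMatrix (Fin q × Fin q)) = swapMatrix (Fin q × Fin q) :=
    fun u => conjPair_of_commute u.2 (swapMatrix_commute_kronecker _)
  simp [twirl, this]

end Locality

/-! ### Domain wall vectors -/

section DomainWall

variable {N q m : ℕ}

/-- The pairing of the copies at one site: along the identity permutation if `c` holds,
and along the transposition of the first two copies otherwise. -/
def sitePairing (c : Prop) [Decidable c] (s r : Fin (m + 2) → Fin q) : ℂ :=
  if (if c then s 0 = r 0 ∧ s 1 = r 1 else s 0 = r 1 ∧ s 1 = r 0) ∧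
    ∀ a : Fin m, s a.succ.succ = r a.succ.succ then 1 else 0

/-- The vector with a domain wall in front of the site `k`: the sites before `k` are paired along
the identity, the other ones along the transposition. -/
def wallVec (N q m k : ℕ) (x : (Fin (m + 2) → Config N q) × (Fin (m + 2) → Config N q)) : ℂ :=
  ∏ i : Fin N, sitePairing (i.1 < k) (fun a => x.1 a i) (fun a => x.2 a i)

/-- The part of a domain wall vector on the sites other than `i`, `j`. -/
def wallRest (m k : ℕ) (i j : Fin N)
    (x : (Fin (m + 2) → Config N q) × (Fin (m + 2) → Config N q)) : ℂ :=
  ∏ l ∈ (Finset.univ.erase i).erase j, sitePairing (l.1 < k) (fun a => x.1 a l) (fun a => x.2 a l)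

theorem wallRest_setPair (k : ℕ) (i j : Fin N)
    (x : (Fin (m + 2) → Config N q) × (Fin (m + 2) → Config N q))
    (s r : Fin (m + 2) → Fin q × Fin q) :
    wallRest m k i j (fun a => setPair i j (x.1 a) (s a), fun a => setPair i j (x.2 a) (r a))
      = wallRest m k i j x := by
  refine Finset.prod_congr rfl fun l hl => ?_
  simp only [Finset.mem_erase] at hl
  simp only [setPair_of_ne hl.2.1 hl.1]

theorem wallRest_congr {k k' : ℕ} {i j : Fin N}
    (h : ∀ l : Fin N, l ≠ i → l ≠ j → (l.1 < k ↔ l.1 < k')) :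
    (wallRest m k i j : (Fin (m + 2) → Config N q) × (Fin (m + 2) → Config N q) → ℂ)
      = wallRest m k' i j := by
  funext x
  refine Finset.prod_congr rfl fun l hl => ?_
  simp only [Finset.mem_erase] at hl
  simp only [h l hl.2.1 hl.1]

/-- The operator on two copies of two sites that corresponds to a pair of pairings. -/
def pairingMatrix (q : ℕ) (c d : Prop) [Decidable c] [Decidable d] :
    Matrix ((Fin q × Fin q) × (Fin q × Fin q)) ((Fin q × Fin q) × (Fin q × Fin q)) ℂ :=
  Matrix.of fun p r =>
    if (if c then p.1.1 = r.1.1 ∧ p.2.1 = r.2.1 else p.1.1 = r.2.1 ∧ p.2.1 = r.1.1) ∧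
      (if d then p.1.2 = r.1.2 ∧ p.2.2 = r.2.2 else p.1.2 = r.2.2 ∧ p.2.2 = r.1.2) then 1 else 0

theorem pairingMatrix_of_true {c d : Prop} [Decidable c] [Decidable d] (hc : c) (hd : d) :
    pairingMatrix q c d = 1 := by
  ext ⟨⟨a, b⟩, ⟨a', b'⟩⟩ ⟨⟨e, f⟩, ⟨e', f'⟩⟩
  simp only [pairingMatrix, Matrix.of_apply, Matrix.one_apply, if_pos hc, if_pos hd,
    Prod.mk.injEq]
  exact if_congr (by tauto) rfl rfl

theorem pairingMatrix_of_false {c d : Prop} [Decidable c] [Decidable d] (hc : ¬ c) (hd : ¬ d) :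
    pairingMatrix q c d = swapMatrix (Fin q × Fin q) := by
  ext ⟨⟨a, b⟩, ⟨a', b'⟩⟩ ⟨⟨e, f⟩, ⟨e', f'⟩⟩
  simp only [pairingMatrix, Matrix.of_apply, swapMatrix, if_neg hc, if_neg hd, Prod.mk.injEq]
  exact if_congr (by tauto) rfl rfl

theorem pairingMatrix_of_true_false {c d : Prop} [Decidable c] [Decidable d] (hc : c)
    (hd : ¬ d) : pairingMatrix q c d = siteSwap q := by
  ext ⟨⟨a, b⟩, ⟨a', b'⟩⟩ ⟨⟨e, f⟩, ⟨e', f'⟩⟩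
  simp only [pairingMatrix, Matrix.of_apply, siteSwap, if_pos hc, if_neg hd]

theorem wallVec_eq_rest_mul (k : ℕ) {i j : Fin N} (h : i ≠ j)
    (x : (Fin (m + 2) → Config N q) × (Fin (m + 2) → Config N q)) :
    wallVec N q m k x
      = wallRest m k i j x * pairVec m (pairingMatrix q (i.1 < k) (j.1 < k)) (pairAt i j x) := by
  rw [wallVec, ← Finset.mul_prod_erase Finset.univ _ (Finset.mem_univ i),
    ← Finset.mul_prod_erase (Finset.univ.erase i) _
      (Finset.mem_erase.mpr ⟨h.symm, Finset.mem_univ j⟩), ← mul_assoc, mul_comm]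
  congr 1
  simp only [sitePairing, pairVec, pairingMatrix, pairAt, Matrix.of_apply, funext_iff,
    Prod.mk.injEq, forall_and]
  rw [ite_zero_mul_ite_zero, ite_zero_mul_ite_zero]
  exact if_congr and_and_and_comm rfl rfl

/-- Both sites of the bond carry the same pairing, so the local operator is the identity or the full
swap, and the twirl fixes either. -/
theorem bondProj_mulVec_wallVec_of_ne (b : Fin (N - 1)) {k : ℕ} (hk : k ≠ b.1 + 1) :
    (bondProj q (m + 2) b).mulVec (wallVec N q m k) = wallVec N q m k := by
  have hij : (⟨b.1, by omega⟩ : Fin N) ≠ ⟨b.1 + 1, by omega⟩ := by simp [Fin.ext_iff]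
  funext x
  conv_lhs => rw [funext (wallVec_eq_rest_mul k hij)]
  rw [wallVec_eq_rest_mul k hij]
  refine (momentOperator_actOn_mulVec hij (wallRest_setPair k _ _) _ x).trans ?_
  congr 2
  rcases Nat.lt_or_ge b.1 k with h | h
  · rw [pairingMatrix_of_true h (show b.1 + 1 < k by omega), twirl_one]
  · rw [pairingMatrix_of_false (show ¬ b.1 < k by omega) (show ¬ b.1 + 1 < k by omega),
      twirl_swap]

/-- With the wall inside the bond the local operator is `siteSwap`. In its twirl, the swap term
moves the wall left of both sites and the identity term moves it right of both. -/
theorem bondProj_mulVec_wallVec_self (hq : 2 ≤ q) (b : Fin (N - 1)) :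
    (bondProj q (m + 2) b).mulVec (wallVec N q m (b.1 + 1))
      = ((q : ℂ) / ((q : ℂ) ^ 2 + 1)) • (wallVec N q m b.1 + wallVec N q m (b.1 + 2)) := by
  have hij : (⟨b.1, by omega⟩ : Fin N) ≠ ⟨b.1 + 1, by omega⟩ := by simp [Fin.ext_iff]
  funext x
  conv_lhs => rw [funext (wallVec_eq_rest_mul (b.1 + 1) hij)]
  refine (momentOperator_actOn_mulVec hij (wallRest_setPair (b.1 + 1) _ _) _ x).trans ?_
  rw [Pi.smul_apply, Pi.add_apply, wallVec_eq_rest_mul b.1 hij, wallVec_eq_rest_mul (b.1 + 2) hij,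
    pairingMatrix_of_true_false (by simp) (by simp), pairingMatrix_of_false (by simp) (by simp),
    pairingMatrix_of_true (by simp) (by simp), twirl_siteSwap hq, pairVec_smul_add,
    wallRest_congr (k := b.1) (k' := b.1 + 1), wallRest_congr (k := b.1 + 2) (k' := b.1 + 1),
    smul_eq_mul]
  · ring
  · intro l h1 h2
    simp only [ne_eq, Fin.ext_iff] at h1 h2
    omega
  · intro l h1 h2
    simp only [ne_eq, Fin.ext_iff] at h1 h2
    omega

end DomainWall

/-! ### The domain wall eigenvalue -/

section Spectrum

variable {N q m : ℕ}

theorem listProj_mulVec_wallVec_of_forall_ne {l : List (Fin (N - 1))} {k : ℕ}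
    (hk : ∀ b ∈ l, k ≠ b.1 + 1) :
    ((l.map (bondProj q (m + 2))).prod).mulVec (wallVec N q m k) = wallVec N q m k := by
  induction l with
  | nil => simp
  | cons b l ih =>
    rw [List.map_cons, List.prod_cons, ← Matrix.mulVec_mulVec,
      ih fun c hc => hk c (List.mem_cons_of_mem _ hc),
      bondProj_mulVec_wallVec_of_ne b (hk b List.mem_cons_self)]

/-- After its one move the wall lies in the middle of no bond of parity `r`, so the other gates of
the layer do nothing. -/
theorem listProj_mulVec_wallVec_of_mem (hq : 2 ≤ q) {r : ℕ} {l : List (Fin (N - 1))}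
    (hl : l.Nodup) (hr : ∀ b ∈ l, b.1 % 2 = r) {b : Fin (N - 1)} (hb : b ∈ l) :
    ((l.map (bondProj q (m + 2))).prod).mulVec (wallVec N q m (b.1 + 1))
      = ((q : ℂ) / ((q : ℂ) ^ 2 + 1)) • (wallVec N q m b.1 + wallVec N q m (b.1 + 2)) := by
  induction l with
  | nil => simp at hb
  | cons c l ih =>
    rw [List.map_cons, List.prod_cons, ← Matrix.mulVec_mulVec]
    have hcl := List.nodup_cons.mp hl
    rcases List.mem_cons.mp hb with rfl | hb'
    · rw [listProj_mulVec_wallVec_of_forall_ne, bondProj_mulVec_wallVec_self hq]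
      intro d hd h
      have : b = d := Fin.ext (by omega)
      exact hcl.1 (this ▸ hd)
    · have hp := hr b hb
      have hp' := hr c List.mem_cons_self
      rw [ih hcl.2 (fun d hd => hr d (List.mem_cons_of_mem _ hd)) hb', Matrix.mulVec_smul,
        Matrix.mulVec_add, bondProj_mulVec_wallVec_of_ne c (by omega),
        bondProj_mulVec_wallVec_of_ne c (by omega)]

theorem layerProj_mulVec_wallVec_of_ne {r k : ℕ} (hk : ∀ b < N - 1, b % 2 = r → k ≠ b + 1) :
    (layerProj N q (m + 2) r).mulVec (wallVec N q m k) = wallVec N q m k := by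
  refine listProj_mulVec_wallVec_of_forall_ne fun b hb => hk b b.2 ?_
  simpa using hb

theorem layerProj_mulVec_wallVec_self (hq : 2 ≤ q) {r k : ℕ} (hk : k < N - 1) (hr : k % 2 = r) :
    (layerProj N q (m + 2) r).mulVec (wallVec N q m (k + 1))
      = ((q : ℂ) / ((q : ℂ) ^ 2 + 1)) • (wallVec N q m k + wallVec N q m (k + 2)) := by
  refine listProj_mulVec_wallVec_of_mem hq (r := r) ((List.nodup_finRange _).filter _) ?_
    (b := ⟨k, hk⟩) ?_
  · intro b hb
    simpa using hb
  · simpa using hr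

theorem transferMatrix_mulVec_wallVec_zero :
    (transferMatrix N q (m + 2)).mulVec (wallVec N q m 0) = wallVec N q m 0 := by
  rw [transferMatrix_eq_mul, ← Matrix.mulVec_mulVec,
    layerProj_mulVec_wallVec_of_ne (by omega), layerProj_mulVec_wallVec_of_ne (by omega)]

theorem transferMatrix_mulVec_wallVec_last :
    (transferMatrix N q (m + 2)).mulVec (wallVec N q m N) = wallVec N q m N := by
  rw [transferMatrix_eq_mul, ← Matrix.mulVec_mulVec,
    layerProj_mulVec_wallVec_of_ne (by omega), layerProj_mulVec_wallVec_of_ne (by omega)]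

/-- Summation by parts for the second-neighbour sum of a sequence. -/
theorem sum_smul_neighbours {E : Type*} [AddCommGroup E] [Module ℂ E] (a : ℕ → ℂ) (f : ℕ → E)
    (M : ℕ) :
    ∑ k ∈ Finset.range M, a (k + 1) • (f k + f (k + 2))
      = ∑ k ∈ Finset.range M, (a k + a (k + 2)) • f (k + 1) + (a 1 • f 0 - a 0 • f 1)
        - (a (M + 1) • f M - a M • f (M + 1)) := by
  induction M with
  | zero => simp
  | succ M ih =>
    rw [Finset.sum_range_succ, Finset.sum_range_succ, ih]
    module

/-- The standing wave of domain walls over the bonds `b` with `b % 2 = r`. -/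
def waveVec (N q m r : ℕ) : (Fin (m + 2) → Config N q) × (Fin (m + 2) → Config N q) → ℂ :=
  ∑ k ∈ Finset.range (N - 1),
    (if k % 2 = r then (Real.sin (((k + 1 : ℕ) : ℝ) * (Real.pi / N)) : ℂ) else 0) •
      wallVec N q m (k + 1)

/-- Summation by parts moves the walk onto the coefficients, where `sin (kθ) + sin ((k + 2)θ) = 2
cos θ sin ((k + 1)θ)`. Each layer shifts the wall by one site, so the parity alternates. -/
theorem layerProj_mulVec_waveVec (hq : 2 ≤ q) (hN : 2 ≤ N) {r r' : ℕ} (hr : r + r' = 1) :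
    ∃ α β : ℂ, (layerProj N q (m + 2) r).mulVec (waveVec N q m r)
      = (2 * ((q : ℂ) / ((q : ℂ) ^ 2 + 1)) * (Real.cos (Real.pi / N) : ℂ)) • waveVec N q m r'
        + (α • wallVec N q m 0 + β • wallVec N q m N) := by
  set w : ℂ := (q : ℂ) / ((q : ℂ) ^ 2 + 1)
  set θ : ℝ := Real.pi / N with hθ
  -- Indexed by wall position rather than bond: bond `k` has its wall at `k + 1`, hence the opposite
  -- parity.
  set a : ℕ → ℂ := fun k => if k % 2 = r' then (Real.sin ((k : ℝ) * θ) : ℂ) else 0 with ha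
  have hNθ : (N : ℝ) * θ = Real.pi := by
    have : (N : ℝ) ≠ 0 := by exact_mod_cast (by omega : N ≠ 0)
    rw [hθ]; field_simp
  have ha0 : a 0 = 0 := by simp [ha]
  have haN : a N = 0 := by simp only [ha, hNθ, Real.sin_pi, Complex.ofReal_zero, ite_self]
  have hpar : ∀ k, (k + 1) % 2 = r' ↔ k % 2 = r := fun k => by omega
  have hasucc : ∀ k, (if k % 2 = r then (Real.sin (((k + 1 : ℕ) : ℝ) * θ) : ℂ) else 0)
      = a (k + 1) := fun k => by simp only [ha, hpar]
  have hstep : ∀ k, a k + a (k + 2) = 2 * (Real.cos θ : ℂ) *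
      (if k % 2 = r' then (Real.sin (((k + 1 : ℕ) : ℝ) * θ) : ℂ) else 0) := by
    intro k
    have h2 : (k + 2) % 2 = k % 2 := by omega
    simp only [ha, h2]
    split_ifs
    · norm_cast
      have e1 : (k : ℝ) * θ = ((k + 1 : ℕ) : ℝ) * θ - θ := by push_cast; ring
      have e2 : ((k + 2 : ℕ) : ℝ) * θ = ((k + 1 : ℕ) : ℝ) * θ + θ := by push_cast; ring
      rw [e1, e2, Real.sin_sub, Real.sin_add]
      ring
    · simp
  have h1 : (layerProj N q (m + 2) r).mulVec (waveVec N q m r)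
      = w • ∑ k ∈ Finset.range (N - 1), a (k + 1) • (wallVec N q m k + wallVec N q m (k + 2)) := by
    rw [waveVec, Matrix.mulVec_sum, Finset.smul_sum]
    refine Finset.sum_congr rfl fun k hk => ?_
    rw [Matrix.mulVec_smul, hasucc]
    by_cases hkr : k % 2 = r
    · rw [layerProj_mulVec_wallVec_self hq (Finset.mem_range.mp hk) hkr, smul_comm]
    · have : a (k + 1) = 0 := by rw [← hasucc, if_neg hkr]
      rw [this, zero_smul, zero_smul, smul_zero]
  have h2 : ∑ k ∈ Finset.range (N - 1), (a k + a (k + 2)) • wallVec N q m (k + 1)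
      = (2 * (Real.cos θ : ℂ)) • waveVec N q m r' := by
    rw [waveVec, Finset.smul_sum]
    refine Finset.sum_congr rfl fun k _ => ?_
    rw [hstep, smul_smul]
  -- Since `a 0 = a N = 0`, the boundary terms contain only the uniform vectors, with these
  -- coefficients.
  refine ⟨w * a 1, w * a (N - 1), ?_⟩
  rw [h1, sum_smul_neighbours, h2, show N - 1 + 1 = N by omega, ha0, haN]
  module

theorem transferMatrix_mulVec_waveVec (hq : 2 ≤ q) (hN : 2 ≤ N) :
    ∃ α β : ℂ, (transferMatrix N q (m + 2)).mulVec (waveVec N q m 1)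
      = ((2 * ((q : ℂ) / ((q : ℂ) ^ 2 + 1)) * (Real.cos (Real.pi / N) : ℂ)) ^ 2) •
          waveVec N q m 1 + (α • wallVec N q m 0 + β • wallVec N q m N) := by
  obtain ⟨α, β, h⟩ := layerProj_mulVec_waveVec (m := m) hq hN (r := 1) (r' := 0) rfl
  obtain ⟨α', β', h'⟩ := layerProj_mulVec_waveVec (m := m) hq hN (r := 0) (r' := 1) rfl
  set μ : ℂ := 2 * ((q : ℂ) / ((q : ℂ) ^ 2 + 1)) * (Real.cos (Real.pi / N) : ℂ)
  refine ⟨μ * α' + α, μ * β' + β, ?_⟩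
  rw [transferMatrix_eq_mul, ← Matrix.mulVec_mulVec, h, Matrix.mulVec_add, Matrix.mulVec_add,
    Matrix.mulVec_smul, Matrix.mulVec_smul, Matrix.mulVec_smul, h',
    layerProj_mulVec_wallVec_of_ne (k := 0) (by omega),
    layerProj_mulVec_wallVec_of_ne (k := N) (by omega)]
  module

/-- A basis configuration that is compatible with the domain wall at `j` only. -/
def wallConfig (N m : ℕ) (hq : 2 ≤ q) (j : ℕ) :
    (Fin (m + 2) → Config N q) × (Fin (m + 2) → Config N q) :=
  (fun a _ => if a = 1 then ⟨1, by omega⟩ else ⟨0, by omega⟩,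
    fun a i => if (if i.1 < j then a = 1 else a = 0) then ⟨1, by omega⟩ else ⟨0, by omega⟩)

/-- The configurations are dual to the wall vectors: at each site the position of the single `1`
among the copies reveals which pairing is used. This serves to show that the candidate eigenvectors
are nonzero. -/
theorem wallVec_wallConfig (hq : 2 ≤ q) {j k : ℕ} (hj : j ≤ N) (hk : k ≤ N) :
    wallVec N q m k (wallConfig N m hq j) = if k = j then 1 else 0 := by
  have hsite : ∀ i : Fin N, sitePairing (i.1 < k) (fun a => (wallConfig N m hq j).1 a i)
      (fun a => (wallConfig N m hq j).2 a i) = if (i.1 < k ↔ i.1 < j) then 1 else 0 := by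
    intro i
    have h1 : ∀ a : Fin m, a.succ.succ ≠ (1 : Fin (m + 2)) := fun a => by
      simp [Fin.ext_iff]
    have h0 : ∀ a : Fin m, a.succ.succ ≠ (0 : Fin (m + 2)) := fun a => Fin.succ_ne_zero _
    by_cases hik : i.1 < k <;> by_cases hij : i.1 < j <;>
      simp [sitePairing, wallConfig, hik, hij, h1, h0]
  rw [wallVec, Finset.prod_congr rfl fun i _ => hsite i]
  simp only [Finset.prod_ite_zero, Finset.prod_const_one, Finset.mem_univ, true_implies]
  refine if_congr ⟨fun h => ?_, fun h => by simp [h]⟩ rfl rfl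
  rcases lt_trichotomy k j with hlt | heq | hlt
  · have := h ⟨k, by omega⟩
    simp at this; omega
  · exact heq
  · have := h ⟨j, by omega⟩
    simp at this; omega

theorem hasEigenvalue_of_mulVec_eq {n : Type*} [Fintype n] [DecidableEq n] {A : Matrix n n ℂ}
    {z : ℂ} {v : n → ℂ} (hv : v ≠ 0) (h : A.mulVec v = z • v) :
    Module.End.HasEigenvalue (Matrix.toLin' A) z :=
  Module.End.hasEigenvalue_of_hasEigenvector
    (Module.End.hasEigenvector_iff.mpr ⟨Module.End.mem_eigenspace_iff.mpr (by simpa using h), hv⟩)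

theorem hasEigenvalue_transferMatrix_one (hq : 2 ≤ q) :
    Module.End.HasEigenvalue (Matrix.toLin' (transferMatrix N q (m + 2))) 1 := by
  refine hasEigenvalue_of_mulVec_eq (v := wallVec N q m 0) (fun h => ?_)
    (by rw [transferMatrix_mulVec_wallVec_zero, one_smul])
  have := congrFun h (wallConfig N m hq 0)
  rw [wallVec_wallConfig hq (Nat.zero_le _) (Nat.zero_le _)] at this
  simp at this

/-- A vector that is an eigenvector modulo the two uniform domains yields an eigenvalue. -/
theorem hasEigenvalue_transferMatrix_of_wall (hq : 2 ≤ q) {z α β : ℂ} (hz : z ≠ 1)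
    {v : (Fin (m + 2) → Config N q) × (Fin (m + 2) → Config N q) → ℂ}
    (hv : (transferMatrix N q (m + 2)).mulVec v
      = z • v + (α • wallVec N q m 0 + β • wallVec N q m N))
    {j : ℕ} (hj0 : 0 < j) (hjN : j < N) (hvj : v (wallConfig N m hq j) ≠ 0) :
    Module.End.HasEigenvalue (Matrix.toLin' (transferMatrix N q (m + 2))) z := by
  -- If `T v = z v + c` and `T c = c`, then `T ((z - 1) v + c) = z ((z - 1) v + c)`. This is nonzero
  -- because `c` vanishes at an interior wall configuration, where `v` does not.
  refine hasEigenvalue_of_mulVec_eq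
    (v := (z - 1) • v + (α • wallVec N q m 0 + β • wallVec N q m N)) (fun h => ?_) ?_
  · have := congrFun h (wallConfig N m hq j)
    simp only [Pi.add_apply, Pi.smul_apply, smul_eq_mul, Pi.zero_apply,
      wallVec_wallConfig hq hjN.le (Nat.zero_le _), wallVec_wallConfig hq hjN.le le_rfl,
      if_neg hj0.ne, if_neg hjN.ne', mul_zero, add_zero] at this
    exact mul_ne_zero (sub_ne_zero.mpr hz) hvj this
  · rw [Matrix.mulVec_add, Matrix.mulVec_add, Matrix.mulVec_smul, Matrix.mulVec_smul,
      Matrix.mulVec_smul, hv, transferMatrix_mulVec_wallVec_zero,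
      transferMatrix_mulVec_wallVec_last]
    module

theorem waveVec_wallConfig (hq : 2 ≤ q) {j r : ℕ} (hj : j < N - 1) (hr : j % 2 = r) :
    waveVec N q m r (wallConfig N m hq (j + 1))
      = (Real.sin (((j + 1 : ℕ) : ℝ) * (Real.pi / N)) : ℂ) := by
  rw [waveVec, Finset.sum_apply, Finset.sum_eq_single j]
  · rw [Pi.smul_apply, wallVec_wallConfig hq (by omega) (by omega), if_pos hr, if_pos rfl,
      smul_eq_mul, mul_one]
  · intro k hk hkj
    rw [Finset.mem_range] at hk
    rw [Pi.smul_apply, wallVec_wallConfig hq (by omega) (by omega),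
      if_neg (show k + 1 ≠ j + 1 by omega), smul_zero]
  · intro h
    exact absurd (Finset.mem_range.mpr hj) h

theorem sq_domainWall_lt_one (hq : 2 ≤ q) (θ : ℝ) :
    (2 * (q : ℝ) / ((q : ℝ) ^ 2 + 1) * Real.cos θ) ^ 2 < 1 := by
  have hq' : (2 : ℝ) ≤ q := by exact_mod_cast hq
  have h1 : 2 * (q : ℝ) / ((q : ℝ) ^ 2 + 1) < 1 := by
    rw [div_lt_one (by positivity)]
    nlinarith
  have h0 : 0 ≤ 2 * (q : ℝ) / ((q : ℝ) ^ 2 + 1) := by positivity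
  rw [mul_pow]
  calc _ ≤ (2 * (q : ℝ) / ((q : ℝ) ^ 2 + 1)) ^ 2 * 1 := by
        gcongr
        exact Real.cos_sq_le_one θ
    _ < 1 := by nlinarith

theorem hasEigenvalue_transferMatrix_domainWall (hN : 2 ≤ N) (hq : 2 ≤ q) :
    Module.End.HasEigenvalue (Matrix.toLin' (transferMatrix N q (m + 2)))
      (((2 * (q : ℝ) / ((q : ℝ) ^ 2 + 1) * Real.cos (Real.pi / (N : ℝ))) ^ 2 : ℝ) : ℂ) := by
  have hlt := sq_domainWall_lt_one hq (Real.pi / (N : ℝ))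
  set z : ℝ := (2 * (q : ℝ) / ((q : ℝ) ^ 2 + 1) * Real.cos (Real.pi / (N : ℝ))) ^ 2 with hz
  have hz1 : (z : ℂ) ≠ 1 := by exact_mod_cast hlt.ne
  -- For `N = 2` the wave over odd-numbered bonds is empty, but `cos (π / 2) = 0`, and the single
  -- interior wall is sent into the uniform vectors: the eigenvalue `0`.
  rcases hN.eq_or_lt with rfl | hN
  · have hz0 : z = 0 := by simp [hz]
    refine hasEigenvalue_transferMatrix_of_wall hq hz1 (v := wallVec 2 q m 1)
      (α := (q : ℂ) / ((q : ℂ) ^ 2 + 1)) (β := (q : ℂ) / ((q : ℂ) ^ 2 + 1)) (j := 1) ?_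
      one_pos one_lt_two ?_
    · rw [transferMatrix_eq_mul, ← Matrix.mulVec_mulVec,
        layerProj_mulVec_wallVec_of_ne (by omega),
        layerProj_mulVec_wallVec_self hq (by omega) (by omega), hz0]
      simp
    · rw [wallVec_wallConfig hq (by omega) (by omega)]
      simp
  · obtain ⟨α, β, h⟩ := transferMatrix_mulVec_waveVec (m := m) hq hN.le
    -- Position `2`, in the middle of bond `1`, is the first one in this wave; its amplitude `sin
    -- (2π / N)` is positive because `N > 2`.
    refine hasEigenvalue_transferMatrix_of_wall hq hz1 (v := waveVec N q m 1) (α := α) (β := β)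
      (j := 2) ?_ two_pos hN ?_
    · rw [h, hz]
      push_cast
      congr 2
      ring
    · rw [waveVec_wallConfig hq (j := 1) (by omega) rfl]
      have hN' : (2 : ℝ) < N := by exact_mod_cast hN
      refine Complex.ofReal_ne_zero.mpr (Real.sin_pos_of_pos_of_lt_pi ?_ ?_).ne'
      · have := Real.pi_pos
        positivity
      · rw [mul_div_assoc', div_lt_iff₀ (by linarith), mul_comm]
        have := Real.pi_pos
        push_cast
        nlinarith

end Spectrum

/-! ### From eigenvalues to the spectral gap -/

theorem finite_eigenvalueMagnitudes {n : Type*} [Fintype n] [DecidableEq n] (A : Matrix n n ℂ) :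
    (eigenvalueMagnitudes A).Finite :=
  (Module.End.finite_hasEigenvalue (Matrix.toLin' A)).image norm

end Brickwork

end

theorem theorem2 (N q t : ℕ) (hN : 2 ≤ N) (hq : 2 ≤ q) (ht : 2 ≤ t) :
    ∃ Δ : ℝ, Brickwork.IsSpectralGap (Brickwork.transferMatrix N q t) Δ ∧
      Δ ≤ 1 - (2 * (q : ℝ) / ((q : ℝ) ^ 2 + 1) * Real.cos (Real.pi / (N : ℝ))) ^ 2 := by
  -- Two copies carry the transposition, and `m` are spectators.
  obtain ⟨m, rfl⟩ := Nat.exists_eq_add_of_le' ht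
  have hlt := Brickwork.sq_domainWall_lt_one hq (Real.pi / (N : ℝ))
  have heig := Brickwork.hasEigenvalue_transferMatrix_domainWall (m := m) hN hq
  set z : ℝ := (2 * (q : ℝ) / ((q : ℝ) ^ 2 + 1) * Real.cos (Real.pi / (N : ℝ))) ^ 2 with hz
  have hz0 : 0 ≤ z := sq_nonneg _
  set s := Brickwork.eigenvalueMagnitudes (Brickwork.transferMatrix N q (m + 2)) with hs
  have hmem : z ∈ s \ {1} :=
    ⟨⟨z, heig, by rw [Complex.norm_real, Real.norm_of_nonneg hz0]⟩, hlt.ne⟩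
  have hone : IsGreatest s 1 := by
    refine ⟨⟨1, Brickwork.hasEigenvalue_transferMatrix_one hq, norm_one⟩, ?_⟩
    rintro r ⟨w, hw, rfl⟩
    exact Brickwork.norm_eigenvalue_transferMatrix_le_one hw
  have hfin : (s \ {1}).Finite :=
    (Brickwork.finite_eigenvalueMagnitudes _).subset Set.sdiff_subset
  -- The domain wall eigenvalue shows that there is a magnitude other than `1`, so the
  -- second-largest one exists, and it is at least `z`.
  obtain ⟨b, hb⟩ := hfin.exists_maximal ⟨z, hmem⟩
  have hbg : IsGreatest (s \ {1}) b :=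
    ⟨hb.1, fun r hr => (le_total r b).elim id fun h => hb.2 hr h⟩
  exact ⟨1 - b, ⟨1, b, hone, hbg, rfl⟩, sub_le_sub_left (hbg.2 hmem) 1⟩
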